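/- Let $T$ be a Tychonoff (completely regular $T_0$) space, and let $C_p(T)$ be the set of all continuous functions $f:T\to\mathbb R$ with the topology inherited from the product $\mathbb R^T$. Call a topological space $X$ - *M-separable* if for every sequence $(D_n)_{n\in\omega}$ of dense subsets of $X$ there are finite sets $F_n\subseteq D_n$ ($n\in\omega$) such that $\bigcup_{n\in\omega}F_n$ is dense in $X$; - *S-separable* if for every sequence $(D_n)_{n\in\omega}$ of dense subsets of $X$ there are finite sets $F_n\subseteq D_n$ ($n\in\omega$) such that for every finite family $\{U_i : i<k\}$ of nonempty open subsets of $X$ there is an $n\in\omega$ with $U_i\cap F_n\neq\emptyset$ for all $i<k$; - *mS-separable* if the condition in the definition of S-separability holds for every decreasing sequence $D_0\supseteq D_1\supseteq\cdots$ of dense subsets of $X$. Then the following conditions are equivalent: 1. $C_p(T)$ is S-separable; 2. $C_p(T)$ is mS-separable; 3. $C_p(T)$ is M-separable. -/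

import Mathlib

/-- `X` is `M`-separable: for every sequence `D` of dense subsets one can pick finite sets
`F n ⊆ D n` whose union is dense. -/
def MSeparable (X : Type*) [TopologicalSpace X] : Prop :=
  ∀ D : ℕ → Set X, (∀ n, Dense (D n)) →
    ∃ F : ℕ → Set X, (∀ n, (F n).Finite ∧ F n ⊆ D n) ∧ Dense (⋃ n, F n)

/-- `F` is a witness of `S`-separability: every finite family of nonempty open sets is met,
all members at once, by a single `F n`. -/
def MeetsFiniteOpenFamilies {X : Type*} [TopologicalSpace X] (F : ℕ → Set X) : Prop :=
  ∀ (k : ℕ) (U : Fin k → Set X), (∀ i, IsOpen (U i) ∧ (U i).Nonempty) →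
    ∃ n, ∀ i, (U i ∩ F n).Nonempty

/-- `X` is `S`-separable: for every sequence `D` of dense subsets one can pick finite sets
`F n ⊆ D n` such that every finite family of nonempty open sets is met by a single `F n`. -/
def SSeparable (X : Type*) [TopologicalSpace X] : Prop :=
  ∀ D : ℕ → Set X, (∀ n, Dense (D n)) →
    ∃ F : ℕ → Set X, (∀ n, (F n).Finite ∧ F n ⊆ D n) ∧ MeetsFiniteOpenFamilies F

/-- `X` is `mS`-separable: the definition of `S`-separability, required only of decreasing
sequences `D 0 ⊇ D 1 ⊇ ⋯` of dense subsets. -/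
def MonoSSeparable (X : Type*) [TopologicalSpace X] : Prop :=
  ∀ D : ℕ → Set X, Antitone D → (∀ n, Dense (D n)) →
    ∃ F : ℕ → Set X, (∀ n, (F n).Finite ∧ F n ⊆ D n) ∧ MeetsFiniteOpenFamilies F

/-- `C_p(T)`: the continuous real functions on `T`, as a subtype of `T → ℝ`, so that instance
search gives it the subspace topology inherited from the product `ℝ^T`. -/
abbrev Cp (T : Type*) [TopologicalSpace T] : Type _ :=
  {f : T → ℝ // Continuous f}

/-!
Call a family of subsets of `T` an `ω`-cover if every finite subset of `T` lies in one of its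
members. `M`-separability of `C_p(T)`, even for decreasing sequences only, gives a countable dense
set and lets one select finite subfamilies from `ω`-covers `𝒰 n`: the functions that for every
`i ≤ n` are constantly `1` off some member of `𝒰 i` form a dense set, and a function which is less
than `1` on a finite set `A` and constantly `1` off `U` witnesses `A ⊆ U`.

Conversely, let `e` be a finite tuple of continuous functions and `ε > 0`. As `f` runs over the
tuples from a dense set, the sets on which `f` is `ε`-close to `e` form an `ω`-cover, so selecting
from `ω`-covers means selecting finite sets one of which approximates all of `e` on a given finite
set. For a countable dense set there are only countably many pairs `(e, 1 / (m + 1))` to treat, and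
distributing the sequence of dense sets among them gives `S`-separability.
-/

open Set Filter TopologicalSpace
open scoped Topology

section Separability

/-- `X` is `mM`-separable: the definition of `M`-separability, required only of decreasing
sequences of dense subsets. It is the weakest of the separability properties considered here. -/
def MonoMSeparable (X : Type*) [TopologicalSpace X] : Prop :=
  ∀ D : ℕ → Set X, Antitone D → (∀ n, Dense (D n)) →
    ∃ F : ℕ → Set X, (∀ n, (F n).Finite ∧ F n ⊆ D n) ∧ Dense (⋃ n, F n)

variable {X : Type*} [TopologicalSpace X]

theorem MeetsFiniteOpenFamilies.dense_iUnion {F : ℕ → Set X} (hF : MeetsFiniteOpenFamilies F) :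
    Dense (⋃ n, F n) := by
  rw [dense_iff_inter_open]
  intro U hU hne
  obtain ⟨n, hn⟩ := hF 1 (fun _ => U) fun _ => ⟨hU, hne⟩
  exact (hn 0).mono (inter_subset_inter_right _ (subset_iUnion F n))

theorem SSeparable.monoSSeparable (h : SSeparable X) : MonoSSeparable X :=
  fun D _ hD => h D hD

theorem SSeparable.mSeparable (h : SSeparable X) : MSeparable X := fun D hD =>
  let ⟨F, hF, hmeet⟩ := h D hD
  ⟨F, hF, hmeet.dense_iUnion⟩

theorem MonoSSeparable.monoMSeparable (h : MonoSSeparable X) : MonoMSeparable X :=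
  fun D hanti hD =>
    let ⟨F, hF, hmeet⟩ := h D hanti hD
    ⟨F, hF, hmeet.dense_iUnion⟩

theorem MSeparable.monoMSeparable (h : MSeparable X) : MonoMSeparable X :=
  fun D _ hD => h D hD

theorem MonoMSeparable.separableSpace (h : MonoMSeparable X) : SeparableSpace X := by
  obtain ⟨F, hF, hdense⟩ := h (fun _ => univ) antitone_const fun _ => dense_univ
  exact ⟨⋃ n, F n, countable_iUnion fun n => (hF n).1.countable, hdense⟩

end Separability

theorem exists_finite_selection_forall_of_countable {X ι α : Type*} [Countable ι]
    {p : Set X → Prop} {Q : ι → α → Set X → Prop}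
    (h : ∀ i, ∀ D : ℕ → Set X, (∀ n, p (D n)) →
      ∃ F : ℕ → Set X, (∀ n, (F n).Finite ∧ F n ⊆ D n) ∧ ∀ a, ∃ n, Q i a (F n))
    {D : ℕ → Set X} (hD : ∀ n, p (D n)) :
    ∃ F : ℕ → Set X, (∀ n, (F n).Finite ∧ F n ⊆ D n) ∧ ∀ i a, ∃ n, Q i a (F n) := by
  rcases isEmpty_or_nonempty ι with _ | _
  · exact ⟨fun _ => ∅, fun _ => ⟨finite_empty, empty_subset _⟩, isEmptyElim⟩
  obtain ⟨g, hg⟩ := exists_surjective_nat ι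
  choose F hF hFQ using fun k => h (g k) (fun n => D (Nat.pair k n)) fun n => hD _
  refine ⟨fun n => F n.unpair.1 n.unpair.2, fun n => ?_, fun i a => ?_⟩
  · simpa only [Nat.pair_unpair] using hF n.unpair.1 n.unpair.2
  · obtain ⟨k, rfl⟩ := hg i
    obtain ⟨n, hn⟩ := hFQ k a
    exact ⟨Nat.pair k n, by simpa only [Nat.unpair_pair] using hn⟩

section Cozero

variable {T : Type*} [TopologicalSpace T]

/-- `U` is a cozero set (a functionally open set): the set where some continuous real function
does not vanish. -/
def IsCozero (U : Set T) : Prop :=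
  ∃ h : T → ℝ, Continuous h ∧ Function.support h = U

theorem isCozero_setOf_lt {f g : T → ℝ} (hf : Continuous f) (hg : Continuous g) :
    IsCozero {t | f t < g t} :=
  ⟨fun t => max (g t - f t) 0, by fun_prop, by ext t; simp⟩

theorem IsCozero.iInter {ι : Type*} [Finite ι] {U : ι → Set T} (hU : ∀ i, IsCozero (U i)) :
    IsCozero (⋂ i, U i) := by
  have := Fintype.ofFinite ι
  choose h hcont hsupp using hU
  refine ⟨fun t => ∏ i, h i t, continuous_finsetProd _ fun i _ => hcont i, ?_⟩
  simp only [Finset.support_prod, hsupp, Finset.mem_univ, iInter_true]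

theorem IsCozero.exists_eqOn_eqOn_compl {U : Set T} (hU : IsCozero U) {A : Finset T}
    (hAU : (A : Set T) ⊆ U) (f g : Cp T) :
    ∃ u : Cp T, EqOn u.1 f.1 A ∧ EqOn u.1 g.1 Uᶜ := by
  obtain ⟨h, hcont, rfl⟩ := hU
  -- The product vanishes on `A` and is `1` wherever `h` vanishes.
  let φ : T → ℝ := fun t => ∏ a ∈ A, (1 - h t / h a)
  have hφ : Continuous φ := by fun_prop
  have hφA : ∀ t ∈ A, φ t = 0 := fun t ht =>
    Finset.prod_eq_zero ht (by rw [div_self (hAU ht), sub_self])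
  have hφU : ∀ t ∉ Function.support h, φ t = 1 := fun t ht => by
    simp [φ, Function.notMem_support.1 ht]
  have hf := f.2
  have hg := g.2
  refine ⟨⟨fun t => f.1 t + φ t * (g.1 t - f.1 t), by fun_prop⟩, fun t ht => ?_, fun t ht => ?_⟩
  · simp [hφA t ht]
  · simp [hφU t ht]

end Cozero

namespace Cp

variable {T : Type*} [TopologicalSpace T]

/-- The basic neighbourhood `[e; A, ε]` of `e` in `C_p(T)`: the functions that are `ε`-close to
`e` at every point of the finite set `A`. -/
def basicNhd (e : Cp T) (A : Finset T) (ε : ℝ) : Set (Cp T) :=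
  {f | ∀ t ∈ A, dist (f.1 t) (e.1 t) < ε}

theorem basicNhd_subset_basicNhd (e : Cp T) {A B : Finset T} {δ ε : ℝ} (hAB : A ⊆ B)
    (hδε : δ ≤ ε) : basicNhd e B δ ⊆ basicNhd e A ε :=
  fun _ hf t ht => (hf t (hAB ht)).trans_le hδε

theorem nhds_basis_basicNhd (e : Cp T) :
    (𝓝 e).HasBasis (fun _ : Finset T × ℕ => True)
      fun p => basicNhd e p.1 (1 / ((p.2 : ℝ) + 1)) := by
  have hpi : (𝓝 e.1).HasBasis (fun p : Set T × ℕ => p.1.Finite ∧ True)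
      fun p => p.1.pi fun t => Metric.ball (e.1 t) (1 / ((p.2 : ℝ) + 1)) := by
    rw [nhds_pi]
    refine hasBasis_pi_same_index (fun t => Metric.nhds_basis_ball_inv_nat_succ) ?_
    intro A m hA _
    obtain ⟨N, hN⟩ := (hA.image m).bddAbove
    exact ⟨N, trivial, fun t ht =>
      Metric.ball_subset_ball (Nat.one_div_le_one_div (hN (mem_image_of_mem m ht)))⟩
  rw [nhds_subtype_eq_comap]
  refine (hpi.comap Subtype.val).to_hasBasis ?_ ?_
  · rintro ⟨A, m⟩ ⟨hA, _⟩
    exact ⟨(hA.toFinset, m), trivial, fun f hf t ht => hf t (hA.mem_toFinset.2 ht)⟩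
  · rintro ⟨A, m⟩ _
    exact ⟨(A, m), ⟨A.finite_toSet, trivial⟩, fun f hf t ht => hf t ht⟩

theorem basicNhd_mem_nhds (e : Cp T) (A : Finset T) {ε : ℝ} (hε : 0 < ε) :
    basicNhd e A ε ∈ 𝓝 e :=
  let ⟨m, hm⟩ := exists_nat_one_div_lt hε
  mem_of_superset ((nhds_basis_basicNhd e).mem_of_mem (i := (A, m)) trivial)
    (basicNhd_subset_basicNhd e subset_rfl hm.le)

theorem dense_of_forall_basicNhd_inter_nonempty {D : Set (Cp T)}
    (hD : ∀ e A, ∀ ε > 0, (basicNhd e A ε ∩ D).Nonempty) : Dense D := fun e =>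
  (mem_closure_iff_nhds_basis' (nhds_basis_basicNhd e)).2 fun p _ =>
    hD e p.1 _ Nat.one_div_pos_of_nat

theorem eventually_basicNhd_subset {e : Cp T} {U : Set (Cp T)} (hU : U ∈ 𝓝 e) :
    ∀ᶠ p : Finset T × ℕ in atTop, basicNhd e p.1 (1 / ((p.2 : ℝ) + 1)) ⊆ U := by
  obtain ⟨p, -, hp⟩ := (nhds_basis_basicNhd e).mem_iff.1 hU
  filter_upwards [eventually_ge_atTop p] with q hpq
  exact (basicNhd_subset_basicNhd e hpq.1 (Nat.one_div_le_one_div hpq.2)).trans hp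

end Cp

section OmegaCovers

/-- `𝒰` is an `ω`-cover of `T`: every finite subset of `T` is contained in a member of `𝒰`. Unlike
in part of the literature, `T` itself may be a member. -/
def IsOmegaCover {T : Type*} (𝒰 : Set (Set T)) : Prop :=
  ∀ A : Finset T, ∃ U ∈ 𝒰, (A : Set T) ⊆ U

/-- The selection principle `S_fin(Ω, Ω)`: from every sequence of `ω`-covers one can pick finite
subfamilies that together form an `ω`-cover. The covers are by cozero sets. In a Tychonoff
space every open `ω`-cover is refined by such a cover, so there the principle is the one for open
`ω`-covers. -/
def OmegaMenger (T : Type*) [TopologicalSpace T] : Prop :=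
  ∀ 𝒰 : ℕ → Set (Set T), (∀ n, ∀ U ∈ 𝒰 n, IsCozero U) → (∀ n, IsOmegaCover (𝒰 n)) →
    ∃ 𝒱 : ℕ → Set (Set T), (∀ n, (𝒱 n).Finite ∧ 𝒱 n ⊆ 𝒰 n) ∧ IsOmegaCover (⋃ n, 𝒱 n)

variable {T : Type*} [TopologicalSpace T]

theorem OmegaMenger.exists_finite_of_image (h : OmegaMenger T) {α : Type*} {V : α → Set T}
    {S : ℕ → Set α} (hV : ∀ a, IsCozero (V a)) (hS : ∀ n, IsOmegaCover (V '' S n)) :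
    ∃ s : ℕ → Set α, (∀ n, (s n).Finite ∧ s n ⊆ S n) ∧ IsOmegaCover (⋃ n, V '' s n) := by
  obtain ⟨𝒱, h𝒱, hcover⟩ := h (fun n => V '' S n) (fun n => by simp [hV]) hS
  choose s hsS hsfin hsV using fun n =>
    exists_subset_image_finite_and (p := (· = 𝒱 n)).1 ⟨𝒱 n, (h𝒱 n).2, (h𝒱 n).1, rfl⟩
  exact ⟨s, fun n => ⟨hsfin n, hsS n⟩, by simpa only [hsV] using hcover⟩

namespace Cp

/-- The functions that, for every `i ≤ n`, are constantly `1` off some member of `𝒰 i`. They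
encode a sequence of `ω`-covers as a sequence of dense subsets of `C_p(T)`; asking for all `i ≤ n`
rather than `i = n` makes that sequence decreasing. -/
def eqOneOff (𝒰 : ℕ → Set (Set T)) (n : ℕ) : Set (Cp T) :=
  {f | ∀ i ≤ n, ∃ U ∈ 𝒰 i, EqOn f.1 1 Uᶜ}

theorem antitone_eqOneOff (𝒰 : ℕ → Set (Set T)) : Antitone (eqOneOff 𝒰) :=
  fun _ _ hmn _ hf i hi => hf i (hi.trans hmn)

theorem dense_eqOneOff {𝒰 : ℕ → Set (Set T)} (hcozero : ∀ n, ∀ U ∈ 𝒰 n, IsCozero U)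
    (hcover : ∀ n, IsOmegaCover (𝒰 n)) (n : ℕ) : Dense (eqOneOff 𝒰 n) := by
  refine dense_of_forall_basicNhd_inter_nonempty fun e A ε hε => ?_
  choose U hU hAU using fun i => hcover i A
  have hW : IsCozero (⋂ i : Iic n, U i) := IsCozero.iInter fun i => hcozero i _ (hU i)
  obtain ⟨f, hfA, hfW⟩ := hW.exists_eqOn_eqOn_compl (subset_iInter fun i => hAU i) e
    ⟨1, continuous_one⟩
  refine ⟨f, fun t ht => by simpa [hfA ht] using hε, fun i hi => ⟨U i, hU i, hfW.mono ?_⟩⟩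
  exact compl_subset_compl.2 (iInter_subset (fun i : Iic n => U i) ⟨i, hi⟩)

end Cp

theorem MonoMSeparable.omegaMenger (h : MonoMSeparable (Cp T)) : OmegaMenger T := by
  intro 𝒰 hcozero hcover
  obtain ⟨F, hF, hdense⟩ := h (Cp.eqOneOff 𝒰) (Cp.antitone_eqOneOff 𝒰)
    (Cp.dense_eqOneOff hcozero hcover)
  choose! U hU𝒰 hU using fun n f (hf : f ∈ F n) => (hF n).2 hf n le_rfl
  refine ⟨fun n => U n '' F n, fun n => ⟨(hF n).1.image _, ?_⟩, fun A => ?_⟩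
  · exact image_subset_iff.2 fun f hf => hU𝒰 n f hf
  · obtain ⟨f, hf, hfA⟩ := hdense.inter_nhds_nonempty
      (Cp.basicNhd_mem_nhds ⟨0, continuous_zero⟩ A one_pos)
    obtain ⟨n, hn⟩ := mem_iUnion.1 hf
    refine ⟨U n f, mem_iUnion.2 ⟨n, mem_image_of_mem _ hn⟩, fun t ht => ?_⟩
    by_contra htU
    have hlt := hfA t ht
    simp [hU n f hn htU] at hlt

theorem OmegaMenger.exists_finite_approx (h : OmegaMenger T) {ι : Type*} [Finite ι]
    (e : ι → Cp T) {ε : ℝ} (hε : 0 < ε) {D : ℕ → Set (Cp T)} (hD : ∀ n, Dense (D n)) :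
    ∃ F : ℕ → Set (Cp T), (∀ n, (F n).Finite ∧ F n ⊆ D n) ∧
      ∀ A : Finset T, ∃ n, ∀ i, (Cp.basicNhd (e i) A ε ∩ F n).Nonempty := by
  let V : (ι → Cp T) → Set T := fun f => ⋂ i, {t | dist ((f i).1 t) ((e i).1 t) < ε}
  have hV : ∀ f, IsCozero (V f) := fun f => IsCozero.iInter fun i =>
    isCozero_setOf_lt ((f i).2.dist (e i).2) continuous_const
  have hcover : ∀ n, IsOmegaCover (V '' {f | ∀ i, f i ∈ D n}) := fun n A => by
    choose f hfD hfA using fun i =>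
      (hD n).inter_nhds_nonempty (Cp.basicNhd_mem_nhds (e i) A hε)
    exact ⟨V f, mem_image_of_mem V hfD, fun t ht => mem_iInter.2 fun i => hfA i t ht⟩
  obtain ⟨s, hs, hscover⟩ := h.exists_finite_of_image hV hcover
  refine ⟨fun n => ⋃ i, (fun f => f i) '' s n, fun n => ⟨?_, ?_⟩, fun A => ?_⟩
  · exact finite_iUnion fun i => (hs n).1.image _
  · exact iUnion_subset fun i => image_subset_iff.2 fun f hf => (hs n).2 hf i
  · obtain ⟨_, hU, hAf⟩ := hscover A
    obtain ⟨n, f, hf, rfl⟩ := mem_iUnion.1 hU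
    exact ⟨n, fun i => ⟨f i, fun t ht => mem_iInter.1 (hAf ht) i,
      mem_iUnion.2 ⟨i, mem_image_of_mem _ hf⟩⟩⟩

theorem OmegaMenger.sSeparable [SeparableSpace (Cp T)] (h : OmegaMenger T) :
    SSeparable (Cp T) := by
  classical
  intro D hD
  obtain ⟨S, hScount, hSdense⟩ := exists_countable_dense (Cp T)
  have := hScount.to_subtype
  obtain ⟨F, hF, happrox⟩ := exists_finite_selection_forall_of_countable
    (ι := Finset S × ℕ) (Q := fun p A F =>
      ∀ e : p.1, (Cp.basicNhd (e : S).1 A (1 / ((p.2 : ℝ) + 1)) ∩ F).Nonempty)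
    (fun p _ => h.exists_finite_approx (fun e : p.1 => (e : S).1) Nat.one_div_pos_of_nat) hD
  refine ⟨F, hF, fun k U hU => ?_⟩
  choose e heU heS using fun i => hSdense.inter_open_nonempty _ (hU i).1 (hU i).2
  obtain ⟨⟨A, m⟩, hAm⟩ := (eventually_all.2 fun i =>
    Cp.eventually_basicNhd_subset ((hU i).1.mem_nhds (heU i))).exists
  let E : Finset S := Finset.univ.image fun i => ⟨e i, heS i⟩
  obtain ⟨n, hn⟩ := happrox (E, m) A
  refine ⟨n, fun i => ?_⟩
  have hiE : ⟨e i, heS i⟩ ∈ E := Finset.mem_image_of_mem _ (Finset.mem_univ i)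
  exact (hn ⟨_, hiE⟩).mono (inter_subset_inter_left _ (hAm i))

theorem MonoMSeparable.sSeparable (h : MonoMSeparable (Cp T)) : SSeparable (Cp T) :=
  have := h.separableSpace
  h.omegaMenger.sSeparable

end OmegaCovers

theorem theorem3_general (T : Type*) [TopologicalSpace T] :
    List.TFAE [SSeparable (Cp T), MonoSSeparable (Cp T), MSeparable (Cp T)] := by
  tfae_have 1 → 2 := SSeparable.monoSSeparable
  tfae_have 2 → 1 := fun h => h.monoMSeparable.sSeparable
  tfae_have 1 → 3 := SSeparable.mSeparable
  tfae_have 3 → 1 := fun h => h.monoMSeparable.sSeparable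
  tfae_finish

theorem theorem3 (T : Type*) [TopologicalSpace T] [T35Space T] :
    List.TFAE [SSeparable (Cp T), MonoSSeparable (Cp T), MSeparable (Cp T)] :=
  theorem3_general T
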